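/- Let $a\ge 0$ and let $r>0$, $p>0$ and $q$ be real continuous functions on $[a,\infty)$. Consider the equation $$(r(x)y'')''-(q(x)y')'=p(x)y \qquad\text{on } [a,\infty),$$ understood in the usual quasi-derivative sense: with $y_1=ry''$ and $Ty=(ry'')'-qy'$, the functions $y,y',y_1,Ty$ are differentiable on $[a,\infty)$ and $(Ty)'=py$. The systems-focal point $\hat\mu_1(a)$ is the smallest $b\in(a,\infty)$ for which the boundary conditions $$y(a)=y_1(a)=y'(b)=Ty(b)=0$$ are satisfied by a nontrivial solution $y$ of the equation (it exists if there is such a smallest $b$). **Theorem (Wirtinger-type inequality).** If $\hat\mu_1(a)$ does not exist, then for each $b\in(a,\infty)$ and each function $w\not\equiv 0$ on $[a,b]$ that is admissible (i.e. $w\in C^1[a,b]$, $w'$ is absolutely continuous and $w''\in L_2[a,b]$) and satisfies $w(a)=w'(b)=0$, we have $$I[w,a,b]=\int_a^b \left(r(w'')^2+q(w')^2-pw^2\right)dx>0.$$ -/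

import Mathlib

open Set MeasureTheory

/-- The derivative of a function on the half-line `[a, ∞)`, one-sided at the end point `a`. -/
noncomputable def rayDeriv (a : ℝ) (y : ℝ → ℝ) : ℝ → ℝ :=
  derivWithin y (Ici a)

/-- The quasi-derivative `y₁ = r y''` on `[a, ∞)`. -/
noncomputable def quasiSnd (a : ℝ) (r y : ℝ → ℝ) : ℝ → ℝ :=
  fun x => r x * rayDeriv a (rayDeriv a y) x

/-- The quasi-derivative `T y = (r y'')' - q y'` on `[a, ∞)`. -/
noncomputable def quasiTrd (a : ℝ) (r q y : ℝ → ℝ) : ℝ → ℝ :=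
  fun x => rayDeriv a (quasiSnd a r y) x - q x * rayDeriv a y x

/-- `y` solves `(r y'')'' - (q y')' = p y` on `[a, ∞)`. As the coefficients are only continuous,
the equation is read in the usual way through quasi-derivatives: `y`, `y'`, `r y''` and
`T y = (r y'')' - q y'` are differentiable and `(T y)' = p y`. -/
structure IsQuasiSolution (a : ℝ) (r q p y : ℝ → ℝ) : Prop where
  diff_zero : DifferentiableOn ℝ y (Ici a)
  diff_one : DifferentiableOn ℝ (rayDeriv a y) (Ici a)
  diff_two : DifferentiableOn ℝ (quasiSnd a r y) (Ici a)
  diff_three : DifferentiableOn ℝ (quasiTrd a r q y) (Ici a)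
  eqn : ∀ x ∈ Ici a, rayDeriv a (quasiTrd a r q y) x = p x * y x

/-- The numbers `b ∈ (a, ∞)` for which some nontrivial solution satisfies
`y(a) = y₁(a) = y'(b) = T y(b) = 0`. -/
def systemsFocalSet (a : ℝ) (r q p : ℝ → ℝ) : Set ℝ :=
  {b | a < b ∧ ∃ y : ℝ → ℝ, IsQuasiSolution a r q p y ∧ (∃ x ∈ Ici a, y x ≠ 0) ∧
    y a = 0 ∧ quasiSnd a r y a = 0 ∧ rayDeriv a y b = 0 ∧ quasiTrd a r q y b = 0}

/-- `b` is the systems-focal point of `a`: the smallest number in `systemsFocalSet`. -/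
def IsSystemsFocalPoint (a : ℝ) (r q p : ℝ → ℝ) (b : ℝ) : Prop :=
  IsLeast (systemsFocalSet a r q p) b

/-- The first derivative of a function on `[a, b]` (one-sided at the end points). -/
noncomputable def fstDeriv (a b : ℝ) (w : ℝ → ℝ) : ℝ → ℝ :=
  derivWithin w (Icc a b)

/-- The second derivative of a function on `[a, b]`. When `w'` is absolutely continuous it exists
almost everywhere; the value `0` at the remaining points is irrelevant for integrals. -/
noncomputable def sndDeriv (a b : ℝ) (w : ℝ → ℝ) : ℝ → ℝ :=
  derivWithin (fstDeriv a b w) (Icc a b)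

/-- Admissible functions on `[a, b]`: `w ∈ C¹[a, b]`, `w'` is absolutely continuous, and
`w'' ∈ L₂[a, b]`. -/
structure IsAdmissible (a b : ℝ) (w : ℝ → ℝ) : Prop where
  contDiff : ContDiffOn ℝ 1 w (Icc a b)
  absCont : AbsolutelyContinuousOnInterval (fstDeriv a b w) a b
  memLp : MemLp (sndDeriv a b w) 2 (volume.restrict (Icc a b))

/-- `I[w, a, b] = ∫_a^b (r (w'')² + q (w')² - p w²) dx`. -/
noncomputable def wirtingerForm (r q p : ℝ → ℝ) (w : ℝ → ℝ) (a b : ℝ) : ℝ :=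
  ∫ x in a..b, (r x * sndDeriv a b w x ^ 2 + q x * fstDeriv a b w x ^ 2 - p x * w x ^ 2)

/-! Put `η = w'` and let `ζ` be the primitive of `p w` with `ζ(b) = 0`. Almost everywhere the
integrand of `I` is `r η'² + q η² + 2ηζ + ζ'²/p - 2(wζ)'`. Up to an exact derivative, `I` is thus a
first order form in the pair `(η, ζ)`, with positive leading part since `r, p > 0`. Its Euler system
is the given equation, for `η = y'`, `ζ = T y`, with momenta `r y''` and `y`.

The solutions whose momenta vanish at `a` form a plane. For a basis of it let `D` be the determinant
of `(y', T y)`; the systems-focal set consists of the zeros of `D` beyond `a`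
(`mem_systemsFocalSet_iff`). For the basis with `D(a) = 1` these zeros have a least element if there
are any, so without a focal point `D` never vanishes.

Then `(η, ζ)` can be expanded in the basis with coefficients `c₁, c₂`, and Picone's identity writes
the integrand as an exact derivative, with equal boundary values, plus a sum of squares in `c₁',
c₂'`. If `I ≤ 0` the squares vanish, the `cᵢ` are constant, and they are zero at `b`; hence `w' = 0`
and `w = 0` (`wirtingerForm_pos_of_det_ne_zero`). -/

/-! ### Linear differential equations on a half-line -/

open scoped BoundedContinuousFunction in
/-- A linear differential equation with continuous coefficients has a global forward solution. -/
theorem exists_forward_solution_linear {E : Type*} [NormedAddCommGroup E] [NormedSpace ℝ E]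
    [CompleteSpace E] {A : ℝ → E →L[ℝ] E} (hA : Continuous A) (a : ℝ) (z₀ : E) :
    ∃ z : ℝ → E, z a = z₀ ∧ ∀ t, a ≤ t → HasDerivAt z (A t (z t)) t := by
  -- The weight `exp (-φ)` turns Picard iteration into a contraction on the whole half-line at once;
  -- the factor 2 produces the constant `1/2`.
  set k : ℝ → ℝ := fun s => 2 * ‖A s‖ with hk
  have hkc : Continuous k := by fun_prop
  set φ : ℝ → ℝ := fun t => ∫ s in a..t, k s with hφ
  have hφd : ∀ t, HasDerivAt φ (k t) t := fun t =>
    (hkc.integral_hasStrictDerivAt a t).hasDerivAt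
  have hφc : Continuous φ := continuous_iff_continuousAt.2 fun t => (hφd t).continuousAt
  have hφa : φ a = 0 := by simp [hφ]
  have hint : ∀ t, ∫ s in a..t, Real.exp (φ s) * ‖A s‖ = (Real.exp (φ t) - 1) / 2 := by
    intro t
    have hd : ∀ s ∈ uIcc a t,
        HasDerivAt (fun s => Real.exp (φ s) / 2) (Real.exp (φ s) * ‖A s‖) s := by
      intro s _
      refine ((hφd s).exp.div_const 2).congr_deriv ?_
      change _ * (2 * ‖A s‖) / 2 = _
      ring
    rw [intervalIntegral.integral_eq_sub_of_hasDerivAt hd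
      ((Continuous.mul (by fun_prop) (by fun_prop)).intervalIntegrable _ _), hφa]
    simp; ring
  -- The unknown is `u = exp (-φ) • z`, which stays bounded although `z` may grow.
  set F : (ℝ →ᵇ E) → ℝ → E := fun u s => Real.exp (φ s) • A s (u s) with hF
  have hFc : ∀ u, Continuous (F u) := by
    intro u
    have := u.continuous
    fun_prop
  set J : (ℝ →ᵇ E) → ℝ → E := fun u t => z₀ + ∫ s in a..t, F u s with hJ
  have hJd : ∀ u t, HasDerivAt (J u) (F u t) t := fun u t =>
    (((hFc u).integral_hasStrictDerivAt a t).hasDerivAt).const_add z₀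
  have hJc : ∀ u, Continuous (J u) := fun u =>
    continuous_iff_continuousAt.2 fun t => (hJd u t).continuousAt
  have hbound : ∀ (u v : ℝ → E) (C : ℝ), Continuous u → Continuous v →
      (∀ s, ‖u s - v s‖ ≤ C) → ∀ t, a ≤ t →
      ‖∫ s in a..t, (Real.exp (φ s) • A s (u s) - Real.exp (φ s) • A s (v s))‖
        ≤ C * ((Real.exp (φ t) - 1) / 2) := by
    intro u v C hu hv hC t ht
    rw [← hint t, ← intervalIntegral.integral_const_mul]
    refine intervalIntegral.norm_integral_le_of_norm_le ht ?_
      (Continuous.intervalIntegrable (by fun_prop) _ _)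
    refine Filter.Eventually.of_forall fun s _ => ?_
    rw [← smul_sub, ← map_sub, norm_smul, Real.norm_eq_abs, abs_of_pos (Real.exp_pos _)]
    calc Real.exp (φ s) * ‖A s (u s - v s)‖
        ≤ Real.exp (φ s) * (‖A s‖ * C) := by
          gcongr
          exact (A s).le_opNorm_of_le (hC s)
      _ = C * (Real.exp (φ s) * ‖A s‖) := by ring
  have hφ0 : ∀ t, a ≤ t → 0 ≤ φ t := fun t ht =>
    intervalIntegral.integral_nonneg ht fun s _ => by positivity
  have hexp : ∀ (C : ℝ) t, 0 ≤ C →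
      Real.exp (-φ t) * (C * ((Real.exp (φ t) - 1) / 2)) ≤ C / 2 := by
    intro C t hC
    have h1 : Real.exp (-φ t) * Real.exp (φ t) = 1 := by rw [← Real.exp_add]; simp
    have h2 := Real.exp_pos (-φ t)
    have : Real.exp (-φ t) * (C * ((Real.exp (φ t) - 1) / 2))
        = C / 2 - Real.exp (-φ t) * C / 2 := by linear_combination (C / 2) * h1
    rw [this]
    have := mul_nonneg h2.le hC
    linarith
  have hPc : ∀ u, Continuous fun t => Real.exp (-φ (max a t)) • J u (max a t) := by
    intro u
    have := hJc u
    fun_prop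
  have hPb : ∀ u t, ‖Real.exp (-φ (max a t)) • J u (max a t)‖ ≤ ‖z₀‖ + ‖u‖ / 2 := by
    intro u t
    have hmt : a ≤ max a t := le_max_left _ _
    have h1 := hbound u 0 ‖u‖ u.continuous continuous_zero
      (fun s => by simpa using u.norm_coe_le_norm s) (max a t) hmt
    simp only [Pi.zero_apply, map_zero, smul_zero, sub_zero] at h1
    have h2 := hexp ‖u‖ (max a t) (norm_nonneg _)
    have h3 : Real.exp (-φ (max a t)) ≤ 1 := by
      rw [Real.exp_le_one_iff]; linarith [hφ0 _ hmt]
    rw [norm_smul, Real.norm_eq_abs, abs_of_pos (Real.exp_pos _)]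
    calc Real.exp (-φ (max a t)) * ‖J u (max a t)‖
        ≤ Real.exp (-φ (max a t)) * (‖z₀‖ + ‖u‖ * ((Real.exp (φ (max a t)) - 1) / 2)) := by
          gcongr
          exact (norm_add_le _ _).trans (by gcongr)
      _ = Real.exp (-φ (max a t)) * ‖z₀‖
          + Real.exp (-φ (max a t)) * (‖u‖ * ((Real.exp (φ (max a t)) - 1) / 2)) := by ring
      _ ≤ 1 * ‖z₀‖ + ‖u‖ / 2 := by gcongr
      _ = _ := by ring
  -- Freezing the time at `a` to the left of `a` keeps the functions bounded on all of `ℝ`.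
  set P : (ℝ →ᵇ E) → (ℝ →ᵇ E) := fun u =>
    BoundedContinuousFunction.ofNormedAddCommGroup
      (fun t => Real.exp (-φ (max a t)) • J u (max a t)) (hPc u) _ (hPb u) with hP
  have hcontr : ContractingWith (1 / 2) P := by
    refine ⟨by norm_num [← NNReal.coe_lt_coe], LipschitzWith.of_dist_le_mul fun u v => ?_⟩
    rw [BoundedContinuousFunction.dist_le (by positivity)]
    intro t
    have hmt : a ≤ max a t := le_max_left _ _
    have h1 := hbound u v (dist u v) u.continuous v.continuous
      (fun s => by rw [← dist_eq_norm]; exact u.dist_coe_le_dist s) (max a t) hmt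
    rw [intervalIntegral.integral_sub ((hFc u).intervalIntegrable _ _)
      ((hFc v).intervalIntegrable _ _)] at h1
    have h2 := hexp (dist u v) (max a t) dist_nonneg
    have h3 : P u t - P v t = Real.exp (-φ (max a t)) •
        ((∫ s in a..max a t, F u s) - ∫ s in a..max a t, F v s) := by
      simp only [hP, hJ, BoundedContinuousFunction.coe_ofNormedAddCommGroup, ← smul_sub]
      congr 1; abel
    rw [dist_eq_norm, h3, norm_smul, Real.norm_eq_abs, abs_of_pos (Real.exp_pos _)]
    calc _ ≤ Real.exp (-φ (max a t)) * (dist u v * ((Real.exp (φ (max a t)) - 1) / 2)) := by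
          gcongr
      _ ≤ dist u v / 2 := h2
      _ = _ := by simp; ring
  set u := ContractingWith.fixedPoint P hcontr
  have hu : P u = u := hcontr.fixedPoint_isFixedPt
  refine ⟨J u, by simp [hJ], fun t ht => ?_⟩
  convert hJd u t using 1
  have h4 : u t = Real.exp (-φ t) • J u t := by
    conv_lhs => rw [← hu]
    simp [hP, max_eq_right ht]
  simp only [hF]
  rw [h4, map_smul, smul_smul, ← Real.exp_add]
  simp

/-- Forward uniqueness for a linear differential equation with continuous coefficients. -/
theorem eqOn_Ici_of_hasDerivWithinAt_linear {E : Type*} [NormedAddCommGroup E] [NormedSpace ℝ E]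
    {A : ℝ → E →L[ℝ] E} (hA : Continuous A) {a : ℝ} {z₁ z₂ : ℝ → E}
    (h₁ : ∀ t ∈ Ici a, HasDerivWithinAt z₁ (A t (z₁ t)) (Ici a) t)
    (h₂ : ∀ t ∈ Ici a, HasDerivWithinAt z₂ (A t (z₂ t)) (Ici a) t) (h : z₁ a = z₂ a) :
    EqOn z₁ z₂ (Ici a) := by
  intro b hb
  obtain ⟨K, hK⟩ := isCompact_Icc.exists_bound_of_continuousOn (hA.continuousOn (s := Icc a b))
  have hK0 : 0 ≤ K := (norm_nonneg _).trans (hK a (left_mem_Icc.2 hb))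
  refine ODE_solution_unique_of_mem_Icc_right (v := fun t => A t) (s := fun _ => univ)
    (K := ⟨K, hK0⟩) (a := a) (b := b) ?_ ?_ ?_ (fun _ _ => mem_univ _) ?_ ?_ (fun _ _ => mem_univ _)
    h ⟨hb, le_rfl⟩
  · intro t ht
    exact ((A t).lipschitz.weaken (show ‖A t‖₊ ≤ ⟨K, hK0⟩ from hK t (Ico_subset_Icc_self ht))).lipschitzOnWith
  · exact fun t ht => ((h₁ t ht.1).continuousWithinAt).mono Icc_subset_Ici_self
  · exact fun t ht => (h₁ t ht.1).mono (Ici_subset_Ici.2 ht.1)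
  · exact fun t ht => ((h₂ t ht.1).continuousWithinAt).mono Icc_subset_Ici_self
  · exact fun t ht => (h₂ t ht.1).mono (Ici_subset_Ici.2 ht.1)

/-! ### The equation as a first order system -/

/-- The first order system satisfied by `(e, f, g, h) = (y', T y, r y'', y)`. -/
structure IsQuasiSystem (a : ℝ) (r q p e f g h : ℝ → ℝ) : Prop where
  deriv_e : ∀ x ∈ Ici a, HasDerivWithinAt e (g x / r x) (Ici a) x
  deriv_f : ∀ x ∈ Ici a, HasDerivWithinAt f (p x * h x) (Ici a) x
  deriv_g : ∀ x ∈ Ici a, HasDerivWithinAt g (f x + q x * e x) (Ici a) x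
  deriv_h : ∀ x ∈ Ici a, HasDerivWithinAt h (e x) (Ici a) x

theorem hasDerivWithinAt_rayDeriv {a : ℝ} {y : ℝ → ℝ} (h : DifferentiableOn ℝ y (Ici a)) {x : ℝ}
    (hx : x ∈ Ici a) : HasDerivWithinAt y (rayDeriv a y x) (Ici a) x :=
  (h x hx).hasDerivWithinAt

theorem rayDeriv_eq_of_hasDerivWithinAt {a : ℝ} {y : ℝ → ℝ} {x y' : ℝ} (hx : x ∈ Ici a)
    (h : HasDerivWithinAt y y' (Ici a) x) : rayDeriv a y x = y' :=
  h.derivWithin (uniqueDiffOn_Ici a x hx)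

theorem IsQuasiSolution.isQuasiSystem {a : ℝ} {r q p y : ℝ → ℝ} (hr : ∀ x ∈ Ici a, 0 < r x)
    (hy : IsQuasiSolution a r q p y) :
    IsQuasiSystem a r q p (rayDeriv a y) (quasiTrd a r q y) (quasiSnd a r y) y where
  deriv_e x hx := by
    refine (hasDerivWithinAt_rayDeriv hy.diff_one hx).congr_deriv ?_
    rw [quasiSnd, mul_div_cancel_left₀ _ (hr x hx).ne']
  deriv_f x hx := (hasDerivWithinAt_rayDeriv hy.diff_three hx).congr_deriv (hy.eqn x hx)
  deriv_g x hx := (hasDerivWithinAt_rayDeriv hy.diff_two hx).congr_deriv (by rw [quasiTrd]; ring)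
  deriv_h x hx := hasDerivWithinAt_rayDeriv hy.diff_zero hx

namespace IsQuasiSystem

variable {a : ℝ} {r q p e f g h e₁ f₁ g₁ h₁ e₂ f₂ g₂ h₂ : ℝ → ℝ}

theorem rayDeriv_eqOn (H : IsQuasiSystem a r q p e f g h) : EqOn (rayDeriv a h) e (Ici a) :=
  fun x hx => rayDeriv_eq_of_hasDerivWithinAt hx (H.deriv_h x hx)

theorem quasiSnd_eqOn (H : IsQuasiSystem a r q p e f g h) (hr : ∀ x ∈ Ici a, 0 < r x) :
    EqOn (quasiSnd a r h) g (Ici a) := fun x hx => by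
  have h1 : rayDeriv a (rayDeriv a h) x = g x / r x :=
    rayDeriv_eq_of_hasDerivWithinAt hx
      ((H.deriv_e x hx).congr (fun t ht => H.rayDeriv_eqOn ht) (H.rayDeriv_eqOn hx))
  rw [quasiSnd, h1, mul_div_cancel₀ _ (hr x hx).ne']

theorem quasiTrd_eqOn (H : IsQuasiSystem a r q p e f g h) (hr : ∀ x ∈ Ici a, 0 < r x) :
    EqOn (quasiTrd a r q h) f (Ici a) := fun x hx => by
  have h1 : rayDeriv a (quasiSnd a r h) x = f x + q x * e x :=
    rayDeriv_eq_of_hasDerivWithinAt hx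
      ((H.deriv_g x hx).congr (fun t ht => H.quasiSnd_eqOn hr ht) (H.quasiSnd_eqOn hr hx))
  rw [quasiTrd, h1, H.rayDeriv_eqOn hx]
  ring

/-- The components agree with the quasi-derivatives of `h` on `[a, ∞)`, and derivatives within `[a,
∞)` see nothing else. -/
theorem isQuasiSolution (H : IsQuasiSystem a r q p e f g h) (hr : ∀ x ∈ Ici a, 0 < r x) :
    IsQuasiSolution a r q p h where
  diff_zero x hx := (H.deriv_h x hx).differentiableWithinAt
  diff_one x hx := (H.deriv_e x hx).differentiableWithinAt.congr
    (fun _ ht => H.rayDeriv_eqOn ht) (H.rayDeriv_eqOn hx)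
  diff_two x hx := (H.deriv_g x hx).differentiableWithinAt.congr
    (fun _ ht => H.quasiSnd_eqOn hr ht) (H.quasiSnd_eqOn hr hx)
  diff_three x hx := (H.deriv_f x hx).differentiableWithinAt.congr
    (fun _ ht => H.quasiTrd_eqOn hr ht) (H.quasiTrd_eqOn hr hx)
  eqn x hx := rayDeriv_eq_of_hasDerivWithinAt hx
    ((H.deriv_f x hx).congr (fun _ ht => H.quasiTrd_eqOn hr ht) (H.quasiTrd_eqOn hr hx))

theorem linear_combination (H₁ : IsQuasiSystem a r q p e₁ f₁ g₁ h₁)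
    (H₂ : IsQuasiSystem a r q p e₂ f₂ g₂ h₂) (s t : ℝ) :
    IsQuasiSystem a r q p (fun x => s * e₁ x + t * e₂ x) (fun x => s * f₁ x + t * f₂ x)
      (fun x => s * g₁ x + t * g₂ x) (fun x => s * h₁ x + t * h₂ x) where
  deriv_e x hx := (((H₁.deriv_e x hx).const_mul s).add ((H₂.deriv_e x hx).const_mul t)).congr_deriv
    (by ring)
  deriv_f x hx := (((H₁.deriv_f x hx).const_mul s).add ((H₂.deriv_f x hx).const_mul t)).congr_deriv
    (by ring)
  deriv_g x hx := (((H₁.deriv_g x hx).const_mul s).add ((H₂.deriv_g x hx).const_mul t)).congr_deriv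
    (by ring)
  deriv_h x hx := ((H₁.deriv_h x hx).const_mul s).add ((H₂.deriv_h x hx).const_mul t)

end IsQuasiSystem

/-! ### Existence and uniqueness for the system -/

/-- The coefficient of the first order system, extended to the real line by constants. -/
noncomputable def quasiSystemCoeff (a : ℝ) (r q p : ℝ → ℝ) (x : ℝ) :
    (ℝ × ℝ × ℝ × ℝ) →L[ℝ] (ℝ × ℝ × ℝ × ℝ) :=
  let e := ContinuousLinearMap.fst ℝ ℝ (ℝ × ℝ × ℝ)
  let f := (ContinuousLinearMap.fst ℝ ℝ (ℝ × ℝ)).comp (ContinuousLinearMap.snd ℝ ℝ (ℝ × ℝ × ℝ))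
  let gh := (ContinuousLinearMap.snd ℝ ℝ (ℝ × ℝ)).comp (ContinuousLinearMap.snd ℝ ℝ (ℝ × ℝ × ℝ))
  let g := (ContinuousLinearMap.fst ℝ ℝ ℝ).comp gh
  let h := (ContinuousLinearMap.snd ℝ ℝ ℝ).comp gh
  ((r (max a x))⁻¹ • g).prod ((p (max a x) • h).prod ((f + q (max a x) • e).prod e))

theorem quasiSystemCoeff_apply {a x : ℝ} (hx : a ≤ x) (r q p : ℝ → ℝ) (z : ℝ × ℝ × ℝ × ℝ) :
    quasiSystemCoeff a r q p x z =
      (z.2.2.1 / r x, p x * z.2.2.2, z.2.1 + q x * z.1, z.1) := by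
  simp [quasiSystemCoeff, max_eq_right hx, div_eq_inv_mul]

theorem ContinuousOn.continuous_comp_max {a : ℝ} {f : ℝ → ℝ} (hf : ContinuousOn f (Ici a)) :
    Continuous fun x => f (max a x) :=
  hf.comp_continuous (by fun_prop) fun x => le_max_left a x

theorem continuous_quasiSystemCoeff {a : ℝ} {r q p : ℝ → ℝ}
    (hr : ContinuousOn r (Ici a)) (hq : ContinuousOn q (Ici a)) (hp : ContinuousOn p (Ici a))
    (hrpos : ∀ x ∈ Ici a, 0 < r x) : Continuous (quasiSystemCoeff a r q p) := by
  have h1 : Continuous fun x => (r (max a x))⁻¹ :=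
    hr.continuous_comp_max.inv₀ fun x => (hrpos _ (le_max_left a x)).ne'
  have h2 := hq.continuous_comp_max
  have h3 := hp.continuous_comp_max
  have hprod : ∀ {F G : Type} [NormedAddCommGroup F] [NormedSpace ℝ F] [NormedAddCommGroup G]
      [NormedSpace ℝ G] {u : ℝ → (ℝ × ℝ × ℝ × ℝ) →L[ℝ] F} {v : ℝ → (ℝ × ℝ × ℝ × ℝ) →L[ℝ] G},
      Continuous u → Continuous v → Continuous fun x => (u x).prod (v x) := by
    intro F G _ _ _ _ u v hu hv
    exact (ContinuousLinearMap.prodₗᵢ (𝕜 := ℝ) (E := ℝ × ℝ × ℝ × ℝ) (F := F) (G := G)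
      ℝ).continuous.comp (hu.prodMk hv)
  unfold quasiSystemCoeff
  exact hprod (h1.smul continuous_const) (hprod (h3.smul continuous_const)
    (hprod (continuous_const.add (h2.smul continuous_const)) continuous_const))

theorem exists_isQuasiSystem {a : ℝ} {r q p : ℝ → ℝ}
    (hr : ContinuousOn r (Ici a)) (hq : ContinuousOn q (Ici a)) (hp : ContinuousOn p (Ici a))
    (hrpos : ∀ x ∈ Ici a, 0 < r x) (e₀ f₀ g₀ h₀ : ℝ) :
    ∃ e f g h : ℝ → ℝ, IsQuasiSystem a r q p e f g h ∧ e a = e₀ ∧ f a = f₀ ∧ g a = g₀ ∧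
      h a = h₀ := by
  obtain ⟨z, hz0, hz⟩ := exists_forward_solution_linear
    (continuous_quasiSystemCoeff hr hq hp hrpos) a (e₀, f₀, g₀, h₀)
  have hz' : ∀ x ∈ Ici a, HasDerivWithinAt z
      (z x |>.2.2.1 / r x, p x * (z x).2.2.2, (z x).2.1 + q x * (z x).1, (z x).1) (Ici a) x := by
    intro x hx
    rw [← quasiSystemCoeff_apply hx]
    exact (hz x hx).hasDerivWithinAt
  exact ⟨fun x => (z x).1, fun x => (z x).2.1, fun x => (z x).2.2.1, fun x => (z x).2.2.2,
    ⟨fun x hx => (hz' x hx).fst, fun x hx => (hz' x hx).snd.fst,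
      fun x hx => (hz' x hx).snd.snd.fst, fun x hx => (hz' x hx).snd.snd.snd⟩,
    by simp [hz0], by simp [hz0], by simp [hz0], by simp [hz0]⟩

theorem IsQuasiSystem.eqOn {a : ℝ} {r q p e₁ f₁ g₁ h₁ e₂ f₂ g₂ h₂ : ℝ → ℝ}
    (hr : ContinuousOn r (Ici a)) (hq : ContinuousOn q (Ici a)) (hp : ContinuousOn p (Ici a))
    (hrpos : ∀ x ∈ Ici a, 0 < r x) (H₁ : IsQuasiSystem a r q p e₁ f₁ g₁ h₁)
    (H₂ : IsQuasiSystem a r q p e₂ f₂ g₂ h₂) (he : e₁ a = e₂ a) (hf : f₁ a = f₂ a)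
    (hg : g₁ a = g₂ a) (hh : h₁ a = h₂ a) :
    EqOn e₁ e₂ (Ici a) ∧ EqOn f₁ f₂ (Ici a) ∧ EqOn h₁ h₂ (Ici a) := by
  have key : ∀ {e f g h : ℝ → ℝ}, IsQuasiSystem a r q p e f g h → ∀ x ∈ Ici a,
      HasDerivWithinAt (fun x => (e x, f x, g x, h x))
        (quasiSystemCoeff a r q p x (e x, f x, g x, h x)) (Ici a) x := by
    intro e f g h H x hx
    rw [quasiSystemCoeff_apply hx]
    exact (H.deriv_e x hx).prodMk ((H.deriv_f x hx).prodMk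
      ((H.deriv_g x hx).prodMk (H.deriv_h x hx)))
  have := eqOn_Ici_of_hasDerivWithinAt_linear (continuous_quasiSystemCoeff hr hq hp hrpos)
    (key H₁) (key H₂) (by simp [he, hf, hg, hh])
  refine ⟨fun x hx => ?_, fun x hx => ?_, fun x hx => ?_⟩ <;>
    have h1 := this hx <;> simp only [Prod.mk.injEq] at h1 <;> tauto

/-! ### Absolute continuity and the Lagrange identity -/

theorem absolutelyContinuousOnInterval_of_hasDerivWithinAt {a b : ℝ} (hab : a ≤ b)
    {f f' : ℝ → ℝ} (hf : ∀ x ∈ Icc a b, HasDerivWithinAt f (f' x) (Icc a b) x)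
    (hf' : ContinuousOn f' (Icc a b)) : AbsolutelyContinuousOnInterval f a b := by
  obtain ⟨K, hK⟩ := isCompact_Icc.exists_bound_of_continuousOn hf'
  have hK0 : 0 ≤ K := (norm_nonneg _).trans (hK a (left_mem_Icc.2 hab))
  have h := (convex_Icc a b).lipschitzOnWith_of_nnnorm_hasDerivWithin_le (C := ⟨K, hK0⟩) hf
    fun x hx => hK x hx
  rw [← uIcc_of_le hab] at h
  exact h.absolutelyContinuousOnInterval

namespace IsQuasiSystem

variable {a b : ℝ} {r q p e f g h e₁ f₁ g₁ h₁ e₂ f₂ g₂ h₂ : ℝ → ℝ}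

theorem continuousOn (H : IsQuasiSystem a r q p e f g h) :
    ContinuousOn e (Ici a) ∧ ContinuousOn f (Ici a) ∧ ContinuousOn g (Ici a) ∧
      ContinuousOn h (Ici a) :=
  ⟨fun x hx => (H.deriv_e x hx).continuousWithinAt, fun x hx => (H.deriv_f x hx).continuousWithinAt,
    fun x hx => (H.deriv_g x hx).continuousWithinAt, fun x hx => (H.deriv_h x hx).continuousWithinAt⟩

theorem absolutelyContinuousOnInterval (H : IsQuasiSystem a r q p e f g h) (hab : a ≤ b)
    (hr : ContinuousOn r (Ici a)) (hq : ContinuousOn q (Ici a)) (hp : ContinuousOn p (Ici a))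
    (hrpos : ∀ x ∈ Ici a, 0 < r x) :
    AbsolutelyContinuousOnInterval e a b ∧ AbsolutelyContinuousOnInterval f a b ∧
      AbsolutelyContinuousOnInterval g a b ∧ AbsolutelyContinuousOnInterval h a b := by
  obtain ⟨ce, cf, cg, ch⟩ := H.continuousOn
  have hs : Icc a b ⊆ Ici a := Icc_subset_Ici_self
  refine ⟨absolutelyContinuousOnInterval_of_hasDerivWithinAt hab
      (fun x hx => (H.deriv_e x (hs hx)).mono hs) ?_,
    absolutelyContinuousOnInterval_of_hasDerivWithinAt hab
      (fun x hx => (H.deriv_f x (hs hx)).mono hs) ?_,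
    absolutelyContinuousOnInterval_of_hasDerivWithinAt hab
      (fun x hx => (H.deriv_g x (hs hx)).mono hs) ?_,
    absolutelyContinuousOnInterval_of_hasDerivWithinAt hab
      (fun x hx => (H.deriv_h x (hs hx)).mono hs) ?_⟩
  · exact (cg.div hr fun x hx => (hrpos x hx).ne').mono hs
  · exact (hp.mul ch).mono hs
  · exact (cf.add (hq.mul ce)).mono hs
  · exact ce.mono hs

/-- Lagrange identity: the symplectic form of two solutions is constant. -/
theorem lagrange_identity (H₁ : IsQuasiSystem a r q p e₁ f₁ g₁ h₁)
    (H₂ : IsQuasiSystem a r q p e₂ f₂ g₂ h₂) {x : ℝ} (hx : x ∈ Ici a) :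
    e₁ x * g₂ x + f₁ x * h₂ x - g₁ x * e₂ x - h₁ x * f₂ x =
      e₁ a * g₂ a + f₁ a * h₂ a - g₁ a * e₂ a - h₁ a * f₂ a := by
  have hd : ∀ t ∈ Ici a, HasDerivWithinAt
      (fun x => e₁ x * g₂ x + f₁ x * h₂ x - g₁ x * e₂ x - h₁ x * f₂ x) 0 (Ici a) t := by
    intro t ht
    refine (((((H₁.deriv_e t ht).mul (H₂.deriv_g t ht)).add
      ((H₁.deriv_f t ht).mul (H₂.deriv_h t ht))).sub
      ((H₁.deriv_g t ht).mul (H₂.deriv_e t ht))).sub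
      ((H₁.deriv_h t ht).mul (H₂.deriv_f t ht))).congr_deriv ?_
    ring
  have := constant_of_derivWithin_zero (a := a) (b := x)
    (f := fun x => e₁ x * g₂ x + f₁ x * h₂ x - g₁ x * e₂ x - h₁ x * f₂ x)
    (fun t ht => ((hd t ht.1).mono Icc_subset_Ici_self).differentiableWithinAt)
    (fun t ht => ((hd t ht.1).mono Icc_subset_Ici_self).derivWithin
      (uniqueDiffOn_Icc (ht.1.trans_lt ht.2) t (Ico_subset_Icc_self ht)))
  exact this x ⟨hx, le_rfl⟩

end IsQuasiSystem

/-! ### Picone's identity and positivity of the form -/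

theorem IsAdmissible.hasDerivWithinAt {a b : ℝ} {w : ℝ → ℝ} (hw : IsAdmissible a b w) {x : ℝ}
    (hx : x ∈ Icc a b) : HasDerivWithinAt w (fstDeriv a b w x) (Icc a b) x :=
  (hw.contDiff.differentiableOn (by norm_num) x hx).hasDerivWithinAt

theorem IsAdmissible.intervalIntegrable {a b : ℝ} (hab : a < b) {r q p w : ℝ → ℝ}
    (hr : ContinuousOn r (Icc a b)) (hq : ContinuousOn q (Icc a b)) (hp : ContinuousOn p (Icc a b))
    (hw : IsAdmissible a b w) :
    IntervalIntegrable (fun x => r x * sndDeriv a b w x ^ 2 + q x * fstDeriv a b w x ^ 2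
      - p x * w x ^ 2) volume a b := by
  have hη : ContinuousOn (fstDeriv a b w) (Icc a b) := by
    simpa [uIcc_of_le hab.le] using hw.absCont.continuousOn
  have h1 : IntervalIntegrable (fun x => r x * sndDeriv a b w x ^ 2) volume a b := by
    rw [intervalIntegrable_iff_integrableOn_Icc_of_le hab.le]
    exact IntegrableOn.continuousOn_mul hr hw.memLp.integrable_sq isCompact_Icc
  have h2 : IntervalIntegrable (fun x => q x * fstDeriv a b w x ^ 2) volume a b :=
    ContinuousOn.intervalIntegrable (by rw [uIcc_of_le hab.le]; exact hq.mul (hη.pow 2))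
  have h3 : IntervalIntegrable (fun x => p x * w x ^ 2) volume a b :=
    ContinuousOn.intervalIntegrable
      (by rw [uIcc_of_le hab.le]; exact hp.mul (hw.contDiff.continuousOn.pow 2))
  exact (h1.add h2).sub h3

/-- If `V` is absolutely continuous with `V a = V b`, and `W = V' + N` almost everywhere with
`0 ≤ N`, then `∫ W ≤ 0` forces `N = 0` almost everywhere. -/
theorem ae_eq_zero_of_integral_nonpos {a b : ℝ} (hab : a ≤ b) {W V N : ℝ → ℝ}
    (hW : IntervalIntegrable W volume a b) (hV : AbsolutelyContinuousOnInterval V a b)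
    (hVab : V a = V b) (hN : ∀ᵐ x, x ∈ Ioo a b → 0 ≤ N x)
    (hWN : ∀ᵐ x, x ∈ Ioo a b → W x = deriv V x + N x) (hle : ∫ x in a..b, W x ≤ 0) :
    ∀ᵐ x, x ∈ Ioo a b → N x = 0 := by
  have hVi := hV.intervalIntegrable_deriv
  have hVint := hV.integral_deriv_eq_sub
  -- `W - V'` stands in for `N`, whose integrability is not assumed.
  have hM : IntervalIntegrable (fun x => W x - deriv V x) volume a b := hW.sub hVi
  have hMint : ∫ x in a..b, (W x - deriv V x) ≤ 0 := by
    rw [intervalIntegral.integral_sub hW hVi, hVint, hVab]; linarith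
  have hnn : 0 ≤ᵐ[volume.restrict (Ioo a b)] fun x => W x - deriv V x := by
    rw [Filter.EventuallyLE, ae_restrict_iff' measurableSet_Ioo]
    filter_upwards [hN, hWN] with x h1 h2 hx
    have := h1 hx
    have := h2 hx
    simp only [Pi.zero_apply]; linarith
  rw [intervalIntegral.integral_of_le hab, integral_Ioc_eq_integral_Ioo] at hMint
  have hMi : IntegrableOn (fun x => W x - deriv V x) (Ioo a b) :=
    (intervalIntegrable_iff_integrableOn_Ioo_of_le hab).1 hM
  have h0 := (integral_eq_zero_iff_of_nonneg_ae hnn hMi).1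
    (le_antisymm hMint (integral_nonneg_of_ae hnn))
  rw [Filter.EventuallyEq, ae_restrict_iff' measurableSet_Ioo] at h0
  filter_upwards [h0, hWN] with x h1 h2 hx
  have := h1 hx
  have := h2 hx
  simp only [Pi.zero_apply] at *; linarith

/-- Picone-type argument: the quadratic form is positive as long as the determinant of
`(y', T y)` for two solutions with `y(a) = y₁(a) = 0` does not vanish. -/
theorem wirtingerForm_pos_of_det_ne_zero {a b : ℝ} (hab : a < b)
    {r q p e₁ f₁ g₁ h₁ e₂ f₂ g₂ h₂ : ℝ → ℝ}
    (hr : ContinuousOn r (Ici a)) (hq : ContinuousOn q (Ici a)) (hp : ContinuousOn p (Ici a))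
    (hrpos : ∀ x ∈ Ici a, 0 < r x) (hppos : ∀ x ∈ Ici a, 0 < p x)
    (H₁ : IsQuasiSystem a r q p e₁ f₁ g₁ h₁) (H₂ : IsQuasiSystem a r q p e₂ f₂ g₂ h₂)
    (hg₁ : g₁ a = 0) (hh₁ : h₁ a = 0) (hg₂ : g₂ a = 0) (hh₂ : h₂ a = 0)
    (hdet : ∀ x ∈ Icc a b, e₁ x * f₂ x - e₂ x * f₁ x ≠ 0)
    {w : ℝ → ℝ} (hw : IsAdmissible a b w) (hw0 : ∃ x ∈ Icc a b, w x ≠ 0) (hwa : w a = 0)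
    (hwb : fstDeriv a b w b = 0) : 0 < wirtingerForm r q p w a b := by
  by_contra! hle
  have hs : Icc a b ⊆ Ici a := Icc_subset_Ici_self
  have hu : uIcc a b = Icc a b := uIcc_of_le hab.le
  set η := fstDeriv a b w with hη
  have hηac : AbsolutelyContinuousOnInterval η a b := hw.absCont
  have hηc : ContinuousOn η (Icc a b) := hu ▸ hηac.continuousOn
  have hwc : ContinuousOn w (Icc a b) := hw.contDiff.continuousOn
  have hwac : AbsolutelyContinuousOnInterval w a b :=
    absolutelyContinuousOnInterval_of_hasDerivWithinAt hab.le
      (fun x hx => hw.hasDerivWithinAt hx) hηc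
  have hpw : ContinuousOn (fun x => p x * w x) (Icc a b) := (hp.mono hs).mul hwc
  have hpwi : IntervalIntegrable (fun x => p x * w x) volume a b :=
    ContinuousOn.intervalIntegrable (by rwa [hu])
  -- The base point `b` gives `ζ(b) = 0`, the counterpart of the condition `T y (b) = 0`.
  set ζ : ℝ → ℝ := fun x => ∫ t in b..x, p t * w t with hζ
  have hζac : AbsolutelyContinuousOnInterval ζ a b :=
    hpwi.absolutelyContinuousOnInterval_intervalIntegral (by simp)
  have hζb : ζ b = 0 := by simp [hζ]
  have hζd : ∀ x ∈ Ioo a b, HasDerivAt ζ (p x * w x) x := by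
    intro x hx
    have hn : Icc a b ∈ nhds x := Icc_mem_nhds hx.1 hx.2
    refine intervalIntegral.integral_hasDerivAt_right
      (hpwi.mono_set ?_).symm ?_ (hpw.continuousAt hn)
    · rw [uIcc_of_le hx.2.le, hu]; exact Icc_subset_Icc_left hx.1.le
    · exact ⟨Icc a b, hn, hpw.aestronglyMeasurable measurableSet_Icc⟩
  obtain ⟨ae₁, af₁, ag₁, ah₁⟩ := H₁.absolutelyContinuousOnInterval hab.le hr hq hp hrpos
  obtain ⟨ae₂, af₂, ag₂, ah₂⟩ := H₂.absolutelyContinuousOnInterval hab.le hr hq hp hrpos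
  obtain ⟨ce₁, cf₁, cg₁, ch₁⟩ := H₁.continuousOn
  obtain ⟨ce₂, cf₂, cg₂, ch₂⟩ := H₂.continuousOn
  have hDinv : AbsolutelyContinuousOnInterval (fun x => (e₁ x * f₂ x - e₂ x * f₁ x)⁻¹) a b := by
    refine absolutelyContinuousOnInterval_of_hasDerivWithinAt hab.le (fun x hx =>
      ((((H₁.deriv_e x (hs hx)).mul (H₂.deriv_f x (hs hx))).sub
      ((H₂.deriv_e x (hs hx)).mul (H₁.deriv_f x (hs hx)))).mono hs).inv (hdet x hx)) ?_
    have hri : ∀ x ∈ Icc a b, r x ≠ 0 := fun x hx => (hrpos x (hs hx)).ne'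
    have hr' := hr.mono hs
    have hp' := hp.mono hs
    replace ce₁ := ce₁.mono hs
    replace ce₂ := ce₂.mono hs
    replace cf₁ := cf₁.mono hs
    replace cf₂ := cf₂.mono hs
    replace cg₁ := cg₁.mono hs
    replace cg₂ := cg₂.mono hs
    replace ch₁ := ch₁.mono hs
    replace ch₂ := ch₂.mono hs
    refine ContinuousOn.div (ContinuousOn.neg ?_) (((ce₁.mul cf₂).sub (ce₂.mul cf₁)).pow 2)
      fun x hx => pow_ne_zero 2 (hdet x hx)
    exact (((cg₁.div hr' hri).mul cf₂).add (ce₁.mul (hp'.mul ch₂))).sub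
      (((cg₂.div hr' hri).mul cf₁).add (ce₂.mul (hp'.mul ch₁)))
  -- Cramer's rule for `(η, ζ) = c₁ (e₁, f₁) + c₂ (e₂, f₂)`.
  set c₁ : ℝ → ℝ := fun x => (f₂ x * η x - e₂ x * ζ x) * (e₁ x * f₂ x - e₂ x * f₁ x)⁻¹ with hc₁
  set c₂ : ℝ → ℝ := fun x => (e₁ x * ζ x - f₁ x * η x) * (e₁ x * f₂ x - e₂ x * f₁ x)⁻¹ with hc₂
  have ac₁ : AbsolutelyContinuousOnInterval c₁ a b :=
    ((af₂.mul hηac).sub (ae₂.mul hζac)).mul hDinv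
  have ac₂ : AbsolutelyContinuousOnInterval c₂ a b :=
    ((ae₁.mul hζac).sub (af₁.mul hηac)).mul hDinv
  have hηeq : ∀ x ∈ Icc a b, e₁ x * c₁ x + e₂ x * c₂ x = η x := by
    intro x hx
    have := mul_inv_cancel₀ (hdet x hx)
    simp only [hc₁, hc₂]
    linear_combination η x * this
  have hζeq : ∀ x ∈ Icc a b, f₁ x * c₁ x + f₂ x * c₂ x = ζ x := by
    intro x hx
    have := mul_inv_cancel₀ (hdet x hx)
    simp only [hc₁, hc₂]
    linear_combination ζ x * this
  -- Pairing of `(η, ζ)` with the momenta of the expansion, corrected by the exact term `-2wζ`.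
  set V : ℝ → ℝ := fun x => η x * (g₁ x * c₁ x + g₂ x * c₂ x)
    + ζ x * (h₁ x * c₁ x + h₂ x * c₂ x) - 2 * (w x * ζ x) with hV
  have hVac : AbsolutelyContinuousOnInterval V a b :=
    ((hηac.mul ((ag₁.mul ac₁).add (ag₂.mul ac₂))).add
      (hζac.mul ((ah₁.mul ac₁).add (ah₂.mul ac₂)))).sub ((hwac.mul hζac).const_mul 2)
  -- Both values are zero: at `a` the momenta and `w` vanish, at `b` both `η` and `ζ` do.
  have hVab : V a = V b := by
    simp only [hV, hg₁, hh₁, hg₂, hh₂, hwa, hwb, hζb]; ring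
  set N : ℝ → ℝ := fun x => r x * (e₁ x * deriv c₁ x + e₂ x * deriv c₂ x) ^ 2
    + (f₁ x * deriv c₁ x + f₂ x * deriv c₂ x) ^ 2 / p x with hN
  have hWi := hw.intervalIntegrable hab (hr.mono hs) (hq.mono hs) (hp.mono hs)
  have hWN : ∀ᵐ x, x ∈ Ioo a b → r x * sndDeriv a b w x ^ 2 + q x * η x ^ 2 - p x * w x ^ 2
      = deriv V x + N x := by
    filter_upwards [hηac.ae_differentiableAt, ac₁.ae_differentiableAt, ac₂.ae_differentiableAt]
      with x d1 d2 d3 hx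
    have hx' : x ∈ Icc a b := Ioo_subset_Icc_self hx
    have hxa : x ∈ Ici a := hs hx'
    have hn : Icc a b ∈ nhds x := Icc_mem_nhds hx.1 hx.2
    have hna : Ici a ∈ nhds x := Ici_mem_nhds hx.1
    rw [hu] at d1 d2 d3
    replace d1 := (d1 hx').hasDerivAt
    replace d2 := (d2 hx').hasDerivAt
    replace d3 := (d3 hx').hasDerivAt
    have hsnd : sndDeriv a b w x = deriv η x := derivWithin_of_mem_nhds hn
    have hwd : HasDerivAt w (η x) x := (hw.hasDerivWithinAt hx').hasDerivAt hn
    have de₁ := (H₁.deriv_e x hxa).hasDerivAt hna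
    have df₁ := (H₁.deriv_f x hxa).hasDerivAt hna
    have dg₁ := (H₁.deriv_g x hxa).hasDerivAt hna
    have dh₁ := (H₁.deriv_h x hxa).hasDerivAt hna
    have de₂ := (H₂.deriv_e x hxa).hasDerivAt hna
    have df₂ := (H₂.deriv_f x hxa).hasDerivAt hna
    have dg₂ := (H₂.deriv_g x hxa).hasDerivAt hna
    have dh₂ := (H₂.deriv_h x hxa).hasDerivAt hna
    have hη' : deriv η x = g₁ x / r x * c₁ x + e₁ x * deriv c₁ x
        + (g₂ x / r x * c₂ x + e₂ x * deriv c₂ x) := by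
      refine d1.unique (((de₁.mul d2).add (de₂.mul d3)).congr_of_eventuallyEq ?_)
      filter_upwards [hn] with t ht using (hηeq t ht).symm
    have hζ' : p x * w x = p x * h₁ x * c₁ x + f₁ x * deriv c₁ x
        + (p x * h₂ x * c₂ x + f₂ x * deriv c₂ x) := by
      refine (hζd x hx).unique (((df₁.mul d2).add (df₂.mul d3)).congr_of_eventuallyEq ?_)
      filter_upwards [hn] with t ht using (hζeq t ht).symm
    have hVd := ((d1.mul ((dg₁.mul d2).add (dg₂.mul d3))).add
      ((hζd x hx).mul ((dh₁.mul d2).add (dh₂.mul d3)))).sub ((hwd.mul (hζd x hx)).const_mul 2)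
    have hsymm := H₁.lagrange_identity H₂ hxa
    rw [hg₁, hh₁, hg₂, hh₂] at hsymm
    have hVd' : deriv V x = _ := hVd.deriv
    have hr0 := (hrpos x hxa).ne'
    have hp0 := (hppos x hxa).ne'
    have e1 := hηeq x hx'
    have e2 := hζeq x hx'
    rw [hVd', hsnd]
    simp only [hN, Pi.mul_apply, Pi.add_apply]
    set γ₁ := deriv c₁ x
    set γ₂ := deriv c₂ x
    set δ := deriv η x
    set α := g₁ x * c₁ x + g₂ x * c₂ x with hα
    set β := h₁ x * c₁ x + h₂ x * c₂ x with hβ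
    have k1 : e₁ x * γ₁ + e₂ x * γ₂ = δ - α / r x := by rw [hη', hα]; ring
    have k2 : f₁ x * γ₁ + f₂ x * γ₂ = p x * (w x - β) := by
      rw [mul_sub, hζ', hβ]; ring
    -- The basis is isotropic: the Lagrange form is zero at `a`, hence everywhere. This lets the
    -- derivatives `γᵢ` and the coefficients `cᵢ` trade places.
    have k3 : η x * (g₁ x * γ₁ + g₂ x * γ₂) + ζ x * (h₁ x * γ₁ + h₂ x * γ₂)
        = α * (δ - α / r x) + β * (p x * (w x - β)) := by
      rw [← k1, ← k2, ← e1, ← e2, hα, hβ]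
      linear_combination (c₁ x * γ₂ - c₂ x * γ₁) * hsymm
    have k4 : (f₁ x + q x * e₁ x) * c₁ x + g₁ x * γ₁ + ((f₂ x + q x * e₂ x) * c₂ x + g₂ x * γ₂)
        = ζ x + q x * η x + (g₁ x * γ₁ + g₂ x * γ₂) := by rw [← e1, ← e2]; ring
    have k5 : e₁ x * c₁ x + h₁ x * γ₁ + (e₂ x * c₂ x + h₂ x * γ₂)
        = η x + (h₁ x * γ₁ + h₂ x * γ₂) := by rw [← e1]; ring
    rw [k4, k5, k1, k2]
    have k6 : r x * (δ - α / r x) ^ 2 = r x * δ ^ 2 - 2 * α * δ + α * (α / r x) := by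
      field_simp; ring
    have k7 : (p x * (w x - β)) ^ 2 / p x = p x * (w x - β) ^ 2 := by field_simp
    rw [k6, k7]
    linear_combination -k3
  have hNnn : ∀ᵐ x, x ∈ Ioo a b → 0 ≤ N x := Filter.Eventually.of_forall fun x hx => by
    have := hrpos x (hs (Ioo_subset_Icc_self hx))
    have := hppos x (hs (Ioo_subset_Icc_self hx))
    positivity
  have hN0 := ae_eq_zero_of_integral_nonpos hab.le hWi hVac hVab hNnn hWN hle
  have hboundary : ∀ᵐ x : ℝ, x ≠ a ∧ x ≠ b :=
    (Measure.ae_ne volume a).and (Measure.ae_ne volume b)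
  have hγ : ∀ᵐ x, x ∈ Icc a b → deriv c₁ x = 0 ∧ deriv c₂ x = 0 := by
    filter_upwards [hN0, hboundary] with x h0 hne hx
    have hx' : x ∈ Ioo a b := ⟨lt_of_le_of_ne hx.1 hne.1.symm, lt_of_le_of_ne hx.2 hne.2⟩
    have hrx := hrpos x (hs hx)
    have hpx := hppos x (hs hx)
    have h0 := h0 hx'
    simp only [hN] at h0
    rw [add_eq_zero_iff_of_nonneg (by positivity) (by positivity)] at h0
    have k1 : e₁ x * deriv c₁ x + e₂ x * deriv c₂ x = 0 := by simpa [hrx.ne'] using h0.1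
    have k2 : f₁ x * deriv c₁ x + f₂ x * deriv c₂ x = 0 := by simpa [hpx.ne'] using h0.2
    refine ⟨?_, ?_⟩ <;> refine (mul_eq_zero.1 ?_).resolve_left (hdet x hx)
    · linear_combination f₂ x * k1 - e₂ x * k2
    · linear_combination e₁ x * k2 - f₁ x * k1
  -- Absolute continuity is essential here: a derivative vanishing almost everywhere would not
  -- otherwise force constancy.
  have hconst : ∀ {c : ℝ → ℝ}, AbsolutelyContinuousOnInterval c a b →
      (∀ᵐ x, x ∈ Icc a b → deriv c x = 0) → c b = 0 → ∀ x ∈ Icc a b, c x = 0 := by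
    intro c hc hc' hcb x hx
    obtain ⟨C, hC⟩ := hc.const_of_ae_hasDerivAt_zero (by
      filter_upwards [hc.ae_differentiableAt, hc'] with t h1 h2 ht
      rw [← h2 (hu ▸ ht)]
      exact (h1 ht).hasDerivAt)
    rw [hC x (hu ▸ hx), ← hC b (by simp), hcb]
  have hc₁0 := hconst ac₁ (hγ.mono fun x h hx => (h hx).1) (by simp [hc₁, hwb, hζb])
  have hc₂0 := hconst ac₂ (hγ.mono fun x h hx => (h hx).2) (by simp [hc₂, hwb, hζb])
  obtain ⟨x, hx, hwx⟩ := hw0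
  refine hwx ?_
  rw [← hwa]
  refine constant_of_derivWithin_zero
    (fun t ht => (hw.hasDerivWithinAt ht).differentiableWithinAt) (fun t ht => ?_) x hx
  have ht' := Ico_subset_Icc_self ht
  change η t = 0
  rw [← hηeq t ht', hc₁0 t ht', hc₂0 t ht']
  ring

/-! ### Focal points as zeros of the determinant -/

theorem exists_ne_zero_of_det_eq_zero {e₁ e₂ f₁ f₂ : ℝ} (hD : e₁ * f₂ - e₂ * f₁ = 0) :
    ∃ s t : ℝ, (s ≠ 0 ∨ t ≠ 0) ∧ s * e₁ + t * e₂ = 0 ∧ s * f₁ + t * f₂ = 0 := by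
  by_cases he : e₁ = 0 ∧ e₂ = 0
  · by_cases hf : f₁ = 0 ∧ f₂ = 0
    · exact ⟨1, 0, by simp, by simp [he.1], by simp [hf.1]⟩
    · exact ⟨f₂, -f₁, by rw [neg_ne_zero]; tauto, by simp [he.1, he.2], by ring⟩
  · exact ⟨e₂, -e₁, by rw [neg_ne_zero]; tauto, by ring, by linear_combination -hD⟩

/-- The systems-focal set is the zero set of the determinant of `(y', T y)` for the two solutions
with `y(a) = y₁(a) = 0` and `(y', T y)(a)` equal to `(1, 0)` and `(0, 1)`. -/
theorem mem_systemsFocalSet_iff {a b : ℝ} (hab : a < b)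
    {r q p e₁ f₁ g₁ h₁ e₂ f₂ g₂ h₂ : ℝ → ℝ}
    (hr : ContinuousOn r (Ici a)) (hq : ContinuousOn q (Ici a)) (hp : ContinuousOn p (Ici a))
    (hrpos : ∀ x ∈ Ici a, 0 < r x)
    (H₁ : IsQuasiSystem a r q p e₁ f₁ g₁ h₁) (H₂ : IsQuasiSystem a r q p e₂ f₂ g₂ h₂)
    (he₁ : e₁ a = 1) (hf₁ : f₁ a = 0) (hg₁ : g₁ a = 0) (hh₁ : h₁ a = 0)
    (he₂ : e₂ a = 0) (hf₂ : f₂ a = 1) (hg₂ : g₂ a = 0) (hh₂ : h₂ a = 0) :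
    b ∈ systemsFocalSet a r q p ↔ e₁ b * f₂ b - e₂ b * f₁ b = 0 := by
  have ha : a ∈ Ici a := self_mem_Ici
  have hb : b ∈ Ici a := hab.le
  constructor
  · rintro ⟨-, y, hy, ⟨x, hx, hyx⟩, hya, hy1, hyb, hTb⟩
    have H := hy.isQuasiSystem hrpos
    obtain ⟨E, F, Y⟩ := H.eqOn hr hq hp hrpos
      (H₁.linear_combination H₂ (rayDeriv a y a) (quasiTrd a r q y a))
      (by simp [he₁, he₂]) (by simp [hf₁, hf₂]) (by simp [hy1, hg₁, hg₂])
      (by simp [hya, hh₁, hh₂])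
    have hE := E hb
    have hF := F hb
    have hY := Y hx
    simp only [hyb, hTb] at hE hF hY
    by_contra hD
    refine hyx ?_
    have hs : rayDeriv a y a = 0 := by
      refine (mul_eq_zero.1 ?_).resolve_right hD
      linear_combination -(f₂ b * hE - e₂ b * hF)
    have ht : quasiTrd a r q y a = 0 := by
      refine (mul_eq_zero.1 ?_).resolve_right hD
      linear_combination f₁ b * hE - e₁ b * hF
    rw [hY, hs, ht]; ring
  · intro hD
    obtain ⟨s, t, hst, h1, h2⟩ := exists_ne_zero_of_det_eq_zero hD
    have H := H₁.linear_combination H₂ s t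
    refine ⟨hab, _, H.isQuasiSolution hrpos, ?_, by simp [hh₁, hh₂], ?_, ?_, ?_⟩
    -- If `y` vanishes identically, so do `y'` and `r y''`, and then `(r y'')' = T y + q y'` gives
    -- `T y (a) = 0`; thus `s = t = 0`.
    · by_contra! hzero
      have H0 : ∀ x, HasDerivWithinAt (fun _ : ℝ => (0 : ℝ)) 0 (Ici a) x := fun x =>
        hasDerivWithinAt_const x _ _
      have hR : EqOn (rayDeriv a fun x => s * h₁ x + t * h₂ x) 0 (Ici a) := fun x hx =>
        rayDeriv_eq_of_hasDerivWithinAt hx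
          ((H0 x).congr (fun u hu => hzero u hu) (hzero x hx))
      have hE : ∀ x ∈ Ici a, s * e₁ x + t * e₂ x = 0 := fun x hx =>
        (H.rayDeriv_eqOn hx).symm.trans (hR hx)
      have hG : ∀ x ∈ Ici a, s * g₁ x + t * g₂ x = 0 := fun x hx => by
        have := (uniqueDiffOn_Ici a x hx).eq_deriv _ (H.deriv_e x hx)
          ((H0 x).congr (fun u hu => hE u hu) (hE x hx))
        simpa [(hrpos x hx).ne'] using this
      have hF := (uniqueDiffOn_Ici a a ha).eq_deriv _ (H.deriv_g a ha)
          ((H0 a).congr (fun u hu => hG u hu) (hG a ha))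
      have hEa := hE a ha
      simp only [he₁, he₂, mul_one, mul_zero, add_zero] at hEa
      simp only [he₁, he₂, hf₁, hf₂, mul_one, mul_zero, add_zero, zero_add, hEa] at hF
      exact hst.elim (· hEa) (· hF)
    · simpa [hg₁, hg₂] using H.quasiSnd_eqOn hrpos ha
    · exact (H.rayDeriv_eqOn hb).trans h1
    · exact (H.quasiTrd_eqOn hrpos hb).trans h2

/-! ### The Wirtinger-type inequality -/

theorem mainTheorem2 (a : ℝ) (ha : 0 ≤ a) (r q p : ℝ → ℝ)
    (hr : ContinuousOn r (Ici a)) (hq : ContinuousOn q (Ici a)) (hp : ContinuousOn p (Ici a))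
    (hrpos : ∀ x ∈ Ici a, 0 < r x) (hppos : ∀ x ∈ Ici a, 0 < p x)
    (hfocal : ¬ ∃ c : ℝ, IsSystemsFocalPoint a r q p c) :
    ∀ b : ℝ, a < b → ∀ w : ℝ → ℝ, IsAdmissible a b w →
      (∃ x ∈ Icc a b, w x ≠ 0) → w a = 0 → fstDeriv a b w b = 0 →
        0 < wirtingerForm r q p w a b := by
  obtain ⟨e₁, f₁, g₁, h₁, H₁, he₁, hf₁, hg₁, hh₁⟩ := exists_isQuasiSystem hr hq hp hrpos 1 0 0 0
  obtain ⟨e₂, f₂, g₂, h₂, H₂, he₂, hf₂, hg₂, hh₂⟩ := exists_isQuasiSystem hr hq hp hrpos 0 1 0 0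
  have hiff : ∀ {b}, a < b → (b ∈ systemsFocalSet a r q p ↔ e₁ b * f₂ b - e₂ b * f₁ b = 0) :=
    fun hab => mem_systemsFocalSet_iff hab hr hq hp hrpos H₁ H₂ he₁ hf₁ hg₁ hh₁ he₂ hf₂ hg₂ hh₂
  have hdet : ∀ x ∈ Ici a, e₁ x * f₂ x - e₂ x * f₁ x ≠ 0 := by
    by_contra! hex
    set Z := Ici a ∩ (fun x => e₁ x * f₂ x - e₂ x * f₁ x) ⁻¹' {0} with hZ
    have hZne : Z.Nonempty := hex
    have hZc : IsClosed Z := by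
      obtain ⟨ce₁, cf₁, -, -⟩ := H₁.continuousOn
      obtain ⟨ce₂, cf₂, -, -⟩ := H₂.continuousOn
      exact ((ce₁.mul cf₂).sub (ce₂.mul cf₁)).preimage_isClosed_of_isClosed isClosed_Ici
        isClosed_singleton
    have hZb : BddBelow Z := ⟨a, fun x hx => hx.1⟩
    have hmem := hZc.csInf_mem hZne hZb
    -- The determinant equals `1` at `a`, so its least zero lies strictly beyond `a` and would be a
    -- systems-focal point.
    have hlt : a < sInf Z := by
      refine lt_of_le_of_ne hmem.1 fun h => ?_
      have h0 : e₁ (sInf Z) * f₂ (sInf Z) - e₂ (sInf Z) * f₁ (sInf Z) = 0 := hmem.2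
      rw [← h, he₁, hf₁, he₂, hf₂] at h0
      norm_num at h0
    exact hfocal ⟨sInf Z, (hiff hlt).2 hmem.2,
      fun c hc => csInf_le hZb ⟨hc.1.le, (hiff hc.1).1 hc⟩⟩
  intro b hab w hw hw0 hwa hwb
  exact wirtingerForm_pos_of_det_ne_zero hab hr hq hp hrpos hppos H₁ H₂ hg₁ hh₁ hg₂ hh₂
    (fun x hx => hdet x hx.1) hw hw0 hwa hwb
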